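/- **Theorem (Complexity–Error Trade-off for Neural Networks).** *Conventions.* $[0,1]^d$ carries the Euclidean distance; "$L$-Lipschitz" means $|f(x)-f(y)|\le L\|x-y\|_2$; the error is the worst-case error $\mathcal E_\infty(f,g)=\sup_{x\in[0,1]^d}|f(x)-g(x)|$. A *neural network* with $d$ inputs is a feedforward network with finitely many fully connected ReLU hidden layers and an affine scalar output layer; its *depth* is the number of its affine layers. It has *weight precision* $p\in\mathbb N$ if all its weights and biases are fixed-point numbers with $p$ fractional and $p$ integer bits, i.e. lie in $2^{-p}\mathbb Z\cap[-2^p,2^p]$. A *Type-2 machine* takes a program $s\in\{0,1\}^*$, an accuracy $k\in\mathbb N$ and an infinite input tape. A program *computes* $g:[0,1]^d\to\mathbb R$ if for every $x\in[0,1]^d$, every tape listing rational points $(q_i)_{i\in\mathbb N}$ with $\|x-q_i\|_2<2^{-i}$, and every $k$, the machine halts with a rational $r$ such that $|g(x)-r|<2^{-k}$. Let $U$ be any *universal prefix-free* Type-2 machine: its set of halting programs is prefix-free, and for every Type-2 machine $M$ whose set of halting programs is prefix-free there is a string $s_M$ such that $U(s_Mp,\cdot)=M(p,\cdot)$ for all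 programs $p$. The *Kolmogorov complexity* $K(g)=K_U(g)$ is the least length of a program computing $g$ on $U$ ($\infty$ if there is none). *Statement.* Fix $U$ and a dimension $d\ge 1$. 1. There is a depth $D$, and for every $B>0$ there are constants $C,c_1,c_2>0$ (so $D$ depends only on $U,d$ and the constants only on $U,d,B$) such that the following holds. Let $L\ge 1/B$, let $f:[0,1]^d\to\mathbb R$ be $L$-Lipschitz with $\sup|f|\le B$, let $\delta>0$, and put $R=\max(L/\delta,2)$ (so $R=L/\delta$ when $\delta\le L/2$). Then there is a neural network $g$ of depth at most $D$ and of some weight precision $p$ with $c_1\log R\le p\le c_2\log R$ (that is, $p=\Theta(\log(L/\delta))$) such that $$\mathcal E_\infty(f,g)\le\delta\qquad\text{and}\qquad K(g)\le C\left(R^d\log R+d\log d\right).$$ In particular, for fixed $f$ and $L>0$, $K(g)=\mathcal O\big((L/\delta)^d\log(L/\delta)+d\log d\big)$ as $\delta\to0$. 2. This order of precision is the minimum required: for every depth bound $D$ there is $c>0$ such that for all $B,L>0$ there is $\delta_0>0$ such that for every $0<\delta<\delta_0$ there is an $L$-Lipschitz $f:[0,1]^d\to[-B,B]$ for which every neural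 network $g$ of depth at most $D$ and weight precision $p$ with $\mathcal E_\infty(f,g)\le\delta$ satisfies $p\ge c\log(L/\delta)$. -/

import Mathlib

open scoped NNReal ENNReal

noncomputable section

/-- The unit cube `[0,1]^d`, with the Euclidean distance inherited from `ℝ^d`. -/
abbrev UnitCube (d : ℕ) : Type :=
  {x : EuclideanSpace ℝ (Fin d) // ∀ i, x i ∈ Set.Icc (0 : ℝ) 1}

/-- The worst-case error `sup_{x ∈ [0,1]^d} |f x - g x|`. -/
def worstCaseError {d : ℕ} (f g : UnitCube d → ℝ) : ℝ≥0∞ :=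
  ⨆ x, edist (f x) (g x)

/-! ### Feedforward ReLU networks -/

/-- Feedforward ReLU networks with `n` real inputs and one real output: finitely many fully
connected hidden layers `x ↦ max (W x + b) 0` followed by an affine output layer. -/
inductive ReLUNetwork : ℕ → Type
  | output {n : ℕ} (w : Fin n → ℝ) (b : ℝ) : ReLUNetwork n
  | hidden {n m : ℕ} (W : Matrix (Fin m) (Fin n) ℝ) (b : Fin m → ℝ) (rest : ReLUNetwork m) :
      ReLUNetwork n

/-- The function `ℝ^n → ℝ` realized by a network. -/
def ReLUNetwork.eval : {n : ℕ} → ReLUNetwork n → (Fin n → ℝ) → ℝ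
  | _, .output w b, x => (∑ i, w i * x i) + b
  | _, .hidden W b rest, x => rest.eval (fun j => max ((∑ i, W j i * x i) + b j) 0)

/-- The number of affine layers (hidden layers and output layer). -/
def ReLUNetwork.depth : {n : ℕ} → ReLUNetwork n → ℕ
  | _, .output _ _ => 1
  | _, .hidden _ _ rest => rest.depth + 1

/-- A real number that is representable in (signed) fixed point with `p` fractional bits and
`p` integer bits: an integer multiple of `2^(-p)` of absolute value at most `2^p`. -/
def IsFixedPoint (p : ℕ) (w : ℝ) : Prop :=
  (∃ z : ℤ, w = z / 2 ^ p) ∧ |w| ≤ 2 ^ p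

/-- All weights and biases of the network have precision `p`. -/
def ReLUNetwork.HasPrecision (p : ℕ) : {n : ℕ} → ReLUNetwork n → Prop
  | _, .output w b => (∀ i, IsFixedPoint p (w i)) ∧ IsFixedPoint p b
  | _, .hidden W b rest =>
      (∀ j i, IsFixedPoint p (W j i)) ∧ (∀ j, IsFixedPoint p (b j)) ∧ rest.HasPrecision p

/-- The function on the unit cube realized by a network with `d` inputs. -/
def ReLUNetwork.onCube {d : ℕ} (N : ReLUNetwork d) (x : UnitCube d) : ℝ :=
  N.eval (fun i => x.1 i)

/-! ### Type-2 machines and Kolmogorov complexity of real functions -/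

/-- A Type-2 machine. Its finite inputs are a program `p : List Bool` and a number `k : ℕ`; its
infinite input is a sequence of natural numbers on a one-way read-only tape. From `p`, `k` and the
finite list of the symbols read so far it computes, by an ordinary (possibly nonterminating)
computation, either `none` ("read the next symbol") or `some v` ("halt with output `v`"). -/
structure TypeTwoMachine where
  step : List Bool × ℕ × List ℕ →. Option ℕ
  partrec : Partrec step

namespace TypeTwoMachine

/-- On program `p`, number `k` and input tape `o` the machine halts with output `v`. -/
def Outputs (M : TypeTwoMachine) (p : List Bool) (k : ℕ) (o : ℕ → ℕ) (v : ℕ) : Prop :=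
  ∃ n : ℕ, some v ∈ M.step (p, k, (List.range n).map o) ∧
    ∀ m < n, none ∈ M.step (p, k, (List.range m).map o)

/-- The programs on which the machine can halt form a prefix-free set. -/
def PrefixFree (M : TypeTwoMachine) : Prop :=
  ∀ p q : List Bool, (∃ k o v, M.Outputs p k o v) → (∃ k o v, M.Outputs q k o v) →
    p <+: q → p = q

/-- A universal prefix-free Type-2 machine: it simulates every prefix-free Type-2 machine `M`
after a fixed string `s` (an interpreter for `M`) has been put in front of the programs. -/
def IsUniversal (U : TypeTwoMachine) : Prop :=
  U.PrefixFree ∧ ∀ M : TypeTwoMachine, M.PrefixFree →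
    ∃ s : List Bool, ∀ p k o v, U.Outputs (s ++ p) k o v ↔ M.Outputs p k o v

end TypeTwoMachine

/-- The standard notation of the rational numbers by natural numbers: the number coding the
triple `((a, b), c)` denotes `(a - b) / (c + 1)`. -/
def ratOfNat (n : ℕ) : ℚ :=
  (((n.unpair.1.unpair.1 : ℕ) : ℚ) - ((n.unpair.1.unpair.2 : ℕ) : ℚ)) / ((n.unpair.2 : ℕ) + 1)

/-- The `i`-th rational point `q_i ∈ ℚ^d` written on the tape `o`, on which the coordinates of
`q_0`, then those of `q_1`, and so on, are listed. -/
def tapePoint {d : ℕ} (o : ℕ → ℕ) (i : ℕ) : EuclideanSpace ℝ (Fin d) :=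
  WithLp.toLp 2 (fun j : Fin d => ((ratOfNat (o (i * d + j)) : ℚ) : ℝ))

/-- The tape `o` holds a rapidly converging sequence of rational points with limit `x`. -/
def IsNameOf {d : ℕ} (o : ℕ → ℕ) (x : UnitCube d) : Prop :=
  ∀ i : ℕ, ‖x.1 - tapePoint o i‖ < (2 : ℝ)⁻¹ ^ i

/-- The program `p` computes the real function `g` on the machine `U`: from every name of a point
`x` and every accuracy `k` it outputs a rational number at distance less than `2^(-k)` from `g x`. -/
def TypeTwoMachine.Computes (U : TypeTwoMachine) (p : List Bool) {d : ℕ}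
    (g : UnitCube d → ℝ) : Prop :=
  ∀ (x : UnitCube d) (o : ℕ → ℕ), IsNameOf o x → ∀ k : ℕ,
    ∃ v : ℕ, U.Outputs p k o v ∧ |g x - ((ratOfNat v : ℚ) : ℝ)| < (2 : ℝ)⁻¹ ^ k

/-- The Kolmogorov complexity of `g` with respect to `U`: the least length of a program that
computes `g` (and `⊤` if there is none). -/
def kolmogorovComplexity (U : TypeTwoMachine) {d : ℕ} (g : UnitCube d → ℝ) : ℕ∞ :=
  ⨅ p : {p : List Bool // U.Computes p g}, (p.1.length : ℕ∞)

end

noncomputable section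

/-! ### The values of networks at lattice points -/

/-! Lower bound: at the origin a network of depth at most `D` and precision `p` takes a value in
`2^(-Dp) ℤ`, since each affine layer adds at most `p` fractional bits and ReLU adds none. A network
within `δ` of the constant `2δ` has a value in `[δ, 3δ]` there, which is positive, so `2^(-Dp) ≤ 3δ`
and `p` is at least of order `log (1/δ)`.

Upper bound: sample `f` on a grid of mesh `2^(-a)`, with `2^a` of order `R`, and quantize the
samples to integers `v i` of `2a + 1` bits. With bumps `b i` around the grid points, the network is
a layer-cake sum over thresholds, `2^(-a) ∑_t min (1, ∑_{v i > t} b i) - 2^a`, written with ReLUs as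
`gridInterpolant`. The data enter only through the comparisons `t < v i`, that is, through weights
`0` and `-1`. Hence depth four and precision `a` suffice (`exists_network_gridInterpolant`), and
every value lies between two quantized samples taken near the point (`gridInterpolant_bounds`).

The function is determined by `a` and the table `v`, so the self-delimiting program `1^a 0 v`
describes it in about `2^(ad) (2a + 1)` bits, which is of order `R^d log R`. A fixed prefix-free
machine decodes this program and evaluates the interpolant exactly at a dyadic approximation of the
input (`interpolantMachine_computes`). Universality of `U` adds only a constant to the length. -/

theorem ReLUNetwork.exists_eval_eq_div {p : ℕ} {n : ℕ} (g : ReLUNetwork n) (hg : g.HasPrecision p)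
    (m : ℕ) (x : Fin n → ℝ) (hx : ∀ i, ∃ z : ℤ, x i = z / 2 ^ m) :
    ∃ z : ℤ, g.eval x = z / 2 ^ (m + g.depth * p) := by
  -- A weight times an input has `m + p` fractional bits, and the bias needs only `p`.
  have affine : ∀ {n : ℕ} (m : ℕ) (w x : Fin n → ℝ) (b : ℝ), (∀ i, ∃ z : ℤ, x i = z / 2 ^ m) →
      (∀ i, IsFixedPoint p (w i)) → IsFixedPoint p b →
      ∃ z : ℤ, (∑ i, w i * x i) + b = z / 2 ^ (m + p) := by
    intro n m w x b hx hw hb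
    choose u hu using hx
    choose v hv using fun i => (hw i).1
    obtain ⟨c, hc⟩ := hb.1
    refine ⟨∑ i, v i * u i + c * 2 ^ m, ?_⟩
    have h2 : (2 : ℝ) ^ m ≠ 0 := by positivity
    have h3 : (2 : ℝ) ^ p ≠ 0 := by positivity
    rw [eq_div_iff (by positivity), add_mul, Finset.sum_mul]
    push_cast
    congr 1
    · refine Finset.sum_congr rfl fun i _ => ?_
      rw [hu, hv, pow_add]
      field_simp
    · rw [hc, pow_add]
      field_simp
  induction g generalizing m with
  | output w b =>
    obtain ⟨hw, hb⟩ := hg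
    simpa [eval, depth] using affine m w x b hx hw hb
  | hidden W b rest ih =>
    obtain ⟨hW, hb, hr⟩ := hg
    have key := ih hr (m + p) (fun j => max ((∑ i, W j i * x i) + b j) 0) (fun j => by
      obtain ⟨z, hz⟩ := affine m (W j) x (b j) hx (hW j) (hb j)
      rcases le_total ((∑ i, W j i * x i) + b j) 0 with h | h
      · exact ⟨0, by simp [h]⟩
      · exact ⟨z, by rw [max_eq_left h, hz]⟩)
    obtain ⟨z, hz⟩ := key
    refine ⟨z, ?_⟩
    rw [eval, hz, depth]
    congr 2
    ring

/-- Every depth bound forces the precision to grow logarithmically in the inverse error: constant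
functions slightly above zero are not resolved by networks of low precision. -/
theorem exists_precision_lower_bound (d D : ℕ) :
    ∃ c : ℝ, 0 < c ∧ ∀ (B : ℝ) (L : ℝ≥0), 0 < B → 0 < L → ∃ δ₀ : ℝ, 0 < δ₀ ∧
      ∀ δ : ℝ, 0 < δ → δ < δ₀ →
        ∃ f : UnitCube d → ℝ, LipschitzWith L f ∧ (∀ x, |f x| ≤ B) ∧
          ∀ (g : ReLUNetwork d) (p : ℕ), g.depth ≤ D → g.HasPrecision p →
            worstCaseError f g.onCube ≤ ENNReal.ofReal δ → c * Real.log (L / δ) ≤ (p : ℝ) := by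
  have hlog2 : 0 < Real.log 2 := Real.log_pos (by norm_num)
  -- The factor 2 comes from the square in `h6`; `D + 1` keeps the denominator positive when `D =
  -- 0`.
  refine ⟨1 / (2 * (D + 1) * Real.log 2), by positivity, fun B L hB hL => ?_⟩
  have hL' : (0 : ℝ) < L := hL
  refine ⟨min (B / 2) (1 / (9 * L)), by positivity, fun δ hδ hδ₀ => ?_⟩
  obtain ⟨h1, h2⟩ := lt_min_iff.1 hδ₀
  refine ⟨fun _ => 2 * δ, LipschitzWith.const' _, fun _ => ?_, fun g p hD hp herr => ?_⟩
  · rw [abs_of_pos (by positivity)]; linarith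
  · let x₀ : UnitCube d := ⟨0, fun i => by simp⟩
    have hx₀ : edist (2 * δ) (g.onCube x₀) ≤ ENNReal.ofReal δ :=
      (le_iSup (fun x => edist (2 * δ) (g.onCube x)) x₀).trans herr
    rw [edist_dist, ENNReal.ofReal_le_ofReal_iff hδ.le, Real.dist_eq] at hx₀
    obtain ⟨z, hz⟩ := g.exists_eval_eq_div hp 0 (fun i => x₀.1 i) (fun i => ⟨0, by simp [x₀]⟩)
    rw [zero_add] at hz
    have hz' : g.onCube x₀ = z / 2 ^ (g.depth * p) := hz
    rw [hz', abs_le] at hx₀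
    have hpow : (0 : ℝ) < 2 ^ (g.depth * p) := by positivity
    have hz1 : (1 : ℝ) ≤ z := by
      have : (0 : ℝ) < z / 2 ^ (g.depth * p) := by linarith
      have : (0 : ℝ) < z := by rwa [div_pos_iff_of_pos_right hpow] at this
      exact_mod_cast this
    have h3 : 1 ≤ 3 * δ * 2 ^ (g.depth * p) := by
      have : (z : ℝ) / 2 ^ (g.depth * p) ≤ 3 * δ := by linarith
      rw [div_le_iff₀ hpow] at this
      linarith
    have h4 : (2 : ℝ) ^ (g.depth * p) ≤ 2 ^ ((D + 1) * p) :=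
      pow_le_pow_right₀ (by norm_num) (Nat.mul_le_mul_right _ (by omega))
    have h5 : 1 ≤ 3 * δ * 2 ^ ((D + 1) * p) := h3.trans (by gcongr)
    -- Since `9 L δ < 1`, `L / δ` is below `1 / (9 δ^2)`, which `h5` squared bounds. This removes
    -- `L` from the constant `c`.
    have h6 : L / δ ≤ (2 ^ ((D + 1) * p)) ^ 2 := by
      rw [div_le_iff₀ hδ]
      rw [lt_div_iff₀ (by positivity)] at h2
      have h7 : 1 ≤ (3 * δ * 2 ^ ((D + 1) * p)) ^ 2 := one_le_pow₀ h5
      have h8 : L * (9 * δ) ≤ 9 * δ * ((2 ^ ((D + 1) * p)) ^ 2 * δ) := by nlinarith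
      nlinarith
    have h9 := Real.log_le_log (by positivity) h6
    rw [Real.log_pow, Real.log_pow] at h9
    push_cast at h9
    rw [one_div, inv_mul_le_iff₀ (by positivity)]
    linarith

/-! ### Networks that interpolate quantized data on a grid -/

/-- The `j`-th digit of `i` in base `N`: the `j`-th coordinate of the `i`-th point of the grid
`{0, …, N - 1}^d`. -/
def gridCoord (N i j : ℕ) : ℕ := i / N ^ j % N

/-- A bump that is `1` at distance at most `1 / N` from `c / N`, and `0` at distance at least
`2 / N`. -/
def gridBump {d : ℕ} (N : ℕ) (c : Fin d → ℕ) (x : Fin d → ℝ) : ℝ :=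
  max (1 - ∑ j, (max (N * x j - (c j + 1)) 0 + max ((c j - 1) - N * x j) 0)) 0

/-- The function with the values `2^(-a) v_i - 2^a` close to the `i`-th point of the grid of mesh
`2^(-a)`. -/
def gridInterpolant {d : ℕ} (a : ℕ) (v : Fin ((2 ^ a) ^ d) → ℕ) (x : Fin d → ℝ) : ℝ :=
  2 ^ a - (2 ^ a)⁻¹ * ∑ t : Fin (2 ^ (2 * a + 1)),
    max (1 - ∑ i, if (t : ℕ) < v i then gridBump (2 ^ a) (fun j => gridCoord (2 ^ a) i j) x else 0) 0

/-- The hidden layers compute the one-sided hinges in each coordinate, then the bumps, then one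
neuron per threshold `t`; the output layer sums these. All weights and biases are integers of
absolute value at most `2^a`, except the output weight `-2^(-a)`. -/
theorem exists_network_gridInterpolant {d : ℕ} (a : ℕ) (v : Fin ((2 ^ a) ^ d) → ℕ) :
    ∃ g : ReLUNetwork d, g.depth = 4 ∧ g.HasPrecision a ∧ g.eval = gridInterpolant a v := by
  -- A neuron of the first layer is indexed by a grid point, a coordinate and a side of the bump.
  let e := (Fintype.equivFin (Fin ((2 ^ a) ^ d) × Fin d × Bool)).symm
  have h1 : (1 : ℝ) ≤ 2 ^ a := one_le_pow₀ (by norm_num)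
  have fix_int : ∀ z : ℤ, |(z : ℝ)| ≤ 2 ^ a → IsFixedPoint a z := fun z hz =>
    ⟨⟨z * 2 ^ a, by push_cast; field_simp⟩, hz⟩
  have fix0 : IsFixedPoint a 0 := by simpa using fix_int 0 (by simp)
  have fix1 : IsFixedPoint a 1 := by simpa using fix_int 1 (by simpa using h1)
  have fixm1 : IsFixedPoint a (-1) := by simpa using fix_int (-1) (by simpa using h1)
  let c : Fin ((2 ^ a) ^ d) → Fin d → ℕ := fun i j => gridCoord (2 ^ a) i j
  have hc : ∀ i j, (c i j : ℝ) + 1 ≤ 2 ^ a := fun i j => by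
    have : c i j < 2 ^ a := Nat.mod_lt _ (by positivity)
    exact_mod_cast this
  refine ⟨.hidden (fun k j => if j = (e k).2.1 then (if (e k).2.2 then 2 ^ a else -2 ^ a) else 0)
      (fun k => if (e k).2.2 then -(c (e k).1 (e k).2.1 + 1) else c (e k).1 (e k).2.1 - 1) <|
    .hidden (fun i k => if (e k).1 = i then -1 else 0) (fun _ => 1) <|
    .hidden (m := 2 ^ (2 * a + 1)) (fun t i => if (t : ℕ) < v i then -1 else 0) (fun _ => 1) <|
    .output (fun _ => -(2 ^ a)⁻¹) (2 ^ a), rfl, ?_, ?_⟩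
  on_goal 1 => simp only [ReLUNetwork.HasPrecision]; refine ⟨?_, ?_, ?_, ?_, ?_, ?_, ?_, ?_⟩
  · intro k j
    split_ifs
    · simpa using fix_int (2 ^ a) (by simp)
    · simpa using fix_int (-2 ^ a) (by simp)
    · exact fix0
  · intro k
    have := hc (e k).1 (e k).2.1
    have h0 : (0 : ℝ) ≤ c (e k).1 (e k).2.1 := by positivity
    split_ifs
    · simpa using fix_int (-(c (e k).1 (e k).2.1 + 1))
        (by push_cast; rw [abs_le]; constructor <;> linarith)
    · simpa using fix_int (c (e k).1 (e k).2.1 - 1)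
        (by push_cast; rw [abs_le]; constructor <;> linarith)
  · intro i k; split_ifs <;> assumption
  · exact fun _ => fix1
  · intro i k; split_ifs <;> assumption
  · exact fun _ => fix1
  · refine fun _ => ⟨⟨-1, by simp [neg_div]⟩, ?_⟩
    rw [abs_neg, abs_of_pos (by positivity)]
    exact (inv_le_one_of_one_le₀ h1).trans h1
  · simpa using fix_int (2 ^ a) (by simp)
  · funext x
    have bump : ∀ i, max ((∑ k, (if (e k).1 = i then (-1 : ℝ) else 0) *
        max ((∑ j, (if j = (e k).2.1 then (if (e k).2.2 then (2 : ℝ) ^ a else -2 ^ a) else 0) * x j)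
          + (if (e k).2.2 then -((c (e k).1 (e k).2.1 : ℝ) + 1) else c (e k).1 (e k).2.1 - 1)) 0)
        + 1) 0 = gridBump (2 ^ a) (c i) x := by
      intro i
      rw [e.sum_comp fun q : Fin ((2 ^ a) ^ d) × Fin d × Bool => (if q.1 = i then (-1 : ℝ) else 0) *
        max ((∑ j, (if j = q.2.1 then (if q.2.2 then (2 : ℝ) ^ a else -2 ^ a) else 0) * x j)
          + (if q.2.2 then -((c q.1 q.2.1 : ℝ) + 1) else c q.1 q.2.1 - 1)) 0]
      rw [Fintype.sum_prod_type, Finset.sum_eq_single i (by simp +contextual) (by simp),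
        Fintype.sum_prod_type, gridBump, sub_eq_add_neg, add_comm, ← Finset.sum_neg_distrib]
      congr 2
      refine Finset.sum_congr rfl fun j _ => ?_
      simp only [Fintype.sum_bool, if_true, ite_mul, zero_mul, Finset.sum_ite_eq',
        Finset.mem_univ, neg_mul, one_mul, Bool.false_eq_true, if_false]
      push_cast
      rw [← neg_add, ← sub_eq_add_neg, neg_add_eq_sub]
    simp only [ReLUNetwork.eval, bump]
    rw [gridInterpolant, ← Finset.mul_sum, neg_mul, neg_add_eq_sub]
    congr 2
    refine Finset.sum_congr rfl fun t _ => ?_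
    rw [sub_eq_add_neg, add_comm, ← Finset.sum_neg_distrib]
    congr 2
    refine Finset.sum_congr rfl fun i _ => ?_
    split_ifs <;> simp [c]

theorem abs_max_zero_sub_le (x y : ℝ) : |max x 0 - max y 0| ≤ |x - y| :=
  abs_max_sub_max_le_abs x y 0

theorem abs_gridBump_sub_le {d : ℕ} (N : ℕ) (c : Fin d → ℕ) {x y : Fin d → ℝ} {ε : ℝ}
    (h : ∀ j, |x j - y j| ≤ ε) : |gridBump N c x - gridBump N c y| ≤ d * (2 * (N * ε)) := by
  refine (abs_max_zero_sub_le _ _).trans ?_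
  rw [sub_sub_sub_cancel_left, ← Finset.sum_sub_distrib]
  refine (Finset.abs_sum_le_sum_abs _ _).trans ?_
  have hj : ∀ j ∈ Finset.univ, |(max (N * y j - (c j + 1)) 0 + max ((c j - 1) - N * y j) 0)
      - (max (N * x j - (c j + 1)) 0 + max ((c j - 1) - N * x j) 0)| ≤ 2 * (N * ε) := by
    intro j _
    rw [add_sub_add_comm, two_mul]
    have hN : |N * y j - N * x j| ≤ N * ε := by
      rw [← mul_sub, abs_mul, Nat.abs_cast, abs_sub_comm]
      exact mul_le_mul_of_nonneg_left (h j) (by positivity)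
    refine (abs_add_le _ _).trans (add_le_add ?_ ?_)
    · refine (abs_max_zero_sub_le _ _).trans ?_
      rwa [sub_sub_sub_cancel_right]
    · refine (abs_max_zero_sub_le _ _).trans ?_
      rwa [sub_sub_sub_cancel_left, abs_sub_comm]
  simpa using Finset.sum_le_sum hj

/-- A crude count: `2^(2a+1)` thresholds with `2^(ad)` bumps each, a bump varying by at most `2 d
2^a ε`, scaled by `2^(-a)`. The constant does not depend on the data, so the machine knows from `a`
and `k` alone how far to read. -/
theorem abs_gridInterpolant_sub_le {d : ℕ} (a : ℕ) (v : Fin ((2 ^ a) ^ d) → ℕ) {x y : Fin d → ℝ}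
    {ε : ℝ} (h : ∀ j, |x j - y j| ≤ ε) (hε : 0 ≤ ε) :
    |gridInterpolant a v x - gridInterpolant a v y| ≤ 2 ^ (2 * a + a * d + 2) * d * ε := by
  rw [gridInterpolant, gridInterpolant, sub_sub_sub_cancel_left, ← mul_sub,
    ← Finset.sum_sub_distrib, abs_mul, abs_of_pos (by positivity)]
  have ht : ∀ t ∈ (Finset.univ : Finset (Fin (2 ^ (2 * a + 1)))),
      |max (1 - ∑ i, if (t : ℕ) < v i then
          gridBump (2 ^ a) (fun j => gridCoord (2 ^ a) i j) y else 0) 0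
        - max (1 - ∑ i, if (t : ℕ) < v i then
          gridBump (2 ^ a) (fun j => gridCoord (2 ^ a) i j) x else 0) 0|
        ≤ (2 ^ a) ^ d * (d * (2 * (2 ^ a * ε))) := by
    intro t _
    refine (abs_max_zero_sub_le _ _).trans ?_
    rw [sub_sub_sub_cancel_left, ← Finset.sum_sub_distrib]
    refine (Finset.abs_sum_le_sum_abs _ _).trans ?_
    have hi : ∀ i ∈ (Finset.univ : Finset (Fin ((2 ^ a) ^ d))),
        |(if (t : ℕ) < v i then gridBump (2 ^ a) (fun j => gridCoord (2 ^ a) i j) x else 0)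
          - (if (t : ℕ) < v i then gridBump (2 ^ a) (fun j => gridCoord (2 ^ a) i j) y else 0)|
          ≤ d * (2 * (2 ^ a * ε)) := by
      intro i _
      split_ifs
      · simpa using abs_gridBump_sub_le (2 ^ a) (fun j : Fin d => gridCoord (2 ^ a) i j) h
      · simpa using (by positivity : 0 ≤ d * (2 * (2 ^ a * ε)))
    simpa using Finset.sum_le_sum hi
  refine (mul_le_mul_of_nonneg_left ((Finset.abs_sum_le_sum_abs _ _).trans
    (Finset.sum_le_sum ht)) (by positivity)).trans (le_of_eq ?_)
  simp only [Finset.sum_const, Finset.card_univ, Fintype.card_fin, nsmul_eq_mul]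
  push_cast
  have h2 : (2 : ℝ) ^ a ≠ 0 := by positivity
  rw [← pow_mul, pow_add, pow_add, pow_add, two_mul, pow_add]
  field_simp

/-- The values of the interpolant at `x` lie between data of grid points close to `x`. -/
theorem gridInterpolant_bounds {d : ℕ} (a : ℕ) (v : Fin ((2 ^ a) ^ d) → ℕ)
    (hv : ∀ i, v i ≤ 2 ^ (2 * a + 1)) (x : Fin d → ℝ) (hx : ∀ j, x j ∈ Set.Icc (0 : ℝ) 1) :
    ∃ i i' : Fin ((2 ^ a) ^ d),
      (∀ j : Fin d, |x j - gridCoord (2 ^ a) i j / 2 ^ a| ≤ 2 / 2 ^ a) ∧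
      (∀ j : Fin d, |x j - gridCoord (2 ^ a) i' j / 2 ^ a| ≤ 2 / 2 ^ a) ∧
      (2 ^ a)⁻¹ * v i - 2 ^ a ≤ gridInterpolant a v x ∧
      gridInterpolant a v x ≤ (2 ^ a)⁻¹ * v i' - 2 ^ a := by
  have hpow : (0 : ℝ) < 2 ^ a := by positivity
  set b : Fin ((2 ^ a) ^ d) → ℝ := fun i => gridBump (2 ^ a) (fun j => gridCoord (2 ^ a) i j) x
    with hb
  have b_nonneg : ∀ i, 0 ≤ b i := fun i => le_max_right _ _
  have close : ∀ i j, |(2 : ℝ) ^ a * x j - gridCoord (2 ^ a) i j| ≤ 2 →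
      |x j - gridCoord (2 ^ a) i j / 2 ^ a| ≤ 2 / 2 ^ a := by
    intro i j h
    rw [le_div_iff₀ hpow, ← abs_of_pos hpow, ← abs_mul, abs_of_pos hpow, sub_mul,
      div_mul_cancel₀ _ hpow.ne', mul_comm]
    exact h
  have b_pos : ∀ i, 0 < b i → ∀ j : Fin d, |x j - gridCoord (2 ^ a) i j / 2 ^ a| ≤ 2 / 2 ^ a := by
    intro i hi j
    refine close i j ?_
    have h1 : 0 < 1 - ∑ j : Fin d, (max (((2 ^ a : ℕ) : ℝ) * x j - (gridCoord (2 ^ a) i j + 1)) 0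
        + max ((gridCoord (2 ^ a) i j - 1) - ((2 ^ a : ℕ) : ℝ) * x j) 0) := by
      rcases lt_max_iff.1 hi with h | h
      · exact h
      · exact absurd h (lt_irrefl _)
    have h2 := Finset.single_le_sum (s := Finset.univ) (f := fun j : Fin d =>
        max (((2 ^ a : ℕ) : ℝ) * x j - (gridCoord (2 ^ a) i j + 1)) 0
        + max ((gridCoord (2 ^ a) i j - 1) - ((2 ^ a : ℕ) : ℝ) * x j) 0)
      (fun j _ => by positivity) (Finset.mem_univ j)
    push_cast at h1 h2
    have h3 := le_max_left ((2 : ℝ) ^ a * x j - (gridCoord (2 ^ a) i j + 1)) 0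
    have h4 := le_max_left ((gridCoord (2 ^ a) i j - 1) - (2 : ℝ) ^ a * x j) 0
    have h5 := le_max_right ((2 : ℝ) ^ a * x j - (gridCoord (2 ^ a) i j + 1)) 0
    have h6 := le_max_right ((gridCoord (2 ^ a) i j - 1) - (2 : ℝ) ^ a * x j) 0
    rw [abs_le]
    constructor <;> linarith
  -- Round each coordinate down to the grid. The cap `2^a - 1` handles `x j = 1`, where the rounded
  -- index would leave the grid; the distance is still at most one mesh.
  obtain ⟨i, hi⟩ : ∃ i, b i = 1 := by
    have hlt : ∀ j, min ⌊2 ^ a * x j⌋₊ (2 ^ a - 1) < 2 ^ a := fun j => by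
      have : 0 < 2 ^ a := by positivity
      omega
    refine ⟨finFunctionFinEquiv fun j => ⟨min ⌊2 ^ a * x j⌋₊ (2 ^ a - 1), hlt j⟩, ?_⟩
    have hcoord : ∀ j : Fin d, gridCoord (2 ^ a)
        (finFunctionFinEquiv fun j : Fin d => (⟨min ⌊2 ^ a * x j⌋₊ (2 ^ a - 1), hlt j⟩ : Fin (2 ^ a))) j
        = min ⌊2 ^ a * x j⌋₊ (2 ^ a - 1) := by
      intro j
      rw [gridCoord, ← finFunctionFinEquiv_symm_apply_val, Equiv.symm_apply_apply]
    have : ∀ j ∈ (Finset.univ : Finset (Fin d)), max (((2 ^ a : ℕ) : ℝ) * x j -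
        ((min ⌊2 ^ a * x j⌋₊ (2 ^ a - 1) : ℕ) + 1)) 0
        + max (((min ⌊2 ^ a * x j⌋₊ (2 ^ a - 1) : ℕ) - 1) - ((2 ^ a : ℕ) : ℝ) * x j) 0 = 0 := by
      intro j _
      have h0 : 0 ≤ 2 ^ a * x j := mul_nonneg hpow.le (hx j).1
      have h1 : (2 : ℝ) ^ a * x j ≤ 2 ^ a := mul_le_of_le_one_right hpow.le (hx j).2
      have h2 := Nat.floor_le h0
      have h3 := Nat.lt_floor_add_one (2 ^ a * x j)
      have h4 : ((2 ^ a - 1 : ℕ) : ℝ) = 2 ^ a - 1 := by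
        rw [Nat.cast_sub Nat.one_le_two_pow]; simp
      push_cast [h4]
      have h5 : min (⌊2 ^ a * x j⌋₊ : ℝ) (2 ^ a - 1) ≤ 2 ^ a * x j := (min_le_left _ _).trans h2
      have h6 : 2 ^ a * x j ≤ min (⌊2 ^ a * x j⌋₊ : ℝ) (2 ^ a - 1) + 1 := by
        rw [← min_add_add_right]
        exact le_min h3.le (by linarith)
      rw [max_eq_right (by linarith), max_eq_right (by linarith), add_zero]
    simp only [hb, hcoord, gridBump]
    rw [Finset.sum_eq_zero this]
    simp
  -- The upper bound uses the largest datum among the bumps that are active at `x`.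
  obtain ⟨i', hi', hmax⟩ := Finset.exists_max_image (Finset.univ.filter fun i => 0 < b i) v
    ⟨i, by simp [hi]⟩
  refine ⟨i, i', b_pos i (by simp [hi]), b_pos i' (by simpa using hi'), ?_, ?_⟩
  all_goals
    rw [gridInterpolant]
    have hT : (2 : ℝ) ^ a = (2 ^ a)⁻¹ * 2 ^ (2 * a + 1) - 2 ^ a := by
      rw [pow_succ, two_mul, pow_add]; field_simp; ring
    have count : ∀ V ≤ 2 ^ (2 * a + 1),
        ∑ t : Fin (2 ^ (2 * a + 1)), (if (t : ℕ) < V then (0 : ℝ) else 1) = 2 ^ (2 * a + 1) - V := by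
      intro V hV
      rw [Fin.sum_univ_eq_sum_range (fun t => if t < V then (0 : ℝ) else 1),
        ← Finset.sum_range_add_sum_Ico _ hV,
        Finset.sum_eq_zero (fun t ht => if_pos (Finset.mem_range.1 ht)),
        Finset.sum_congr rfl (fun t ht => if_neg (not_lt.2 (Finset.mem_Ico.1 ht).1))]
      simp [Nat.cast_sub hV]
  -- For `t < v i` the bump `b i = 1` alone switches the threshold neuron off.
  · have hs : ∑ t : Fin (2 ^ (2 * a + 1)), max (1 - ∑ i, if (t : ℕ) < v i then b i else 0) 0
        ≤ 2 ^ (2 * a + 1) - v i := by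
      rw [← count _ (hv i)]
      refine Finset.sum_le_sum fun t _ => ?_
      have h0 : ∀ i, 0 ≤ if (t : ℕ) < v i then b i else 0 := fun i => by
        split_ifs; exacts [b_nonneg i, le_rfl]
      split_ifs with ht
      · have := Finset.single_le_sum (s := Finset.univ)
          (f := fun i => if (t : ℕ) < v i then b i else 0) (fun i _ => h0 i) (Finset.mem_univ i)
        simp only [ht, if_true, hi] at this
        exact max_le (by linarith) le_rfl
      · exact max_le (by linarith [Finset.sum_nonneg fun i (_ : i ∈ Finset.univ) => h0 i]) (by simp)
    have := mul_le_mul_of_nonneg_left hs (inv_nonneg.2 hpow.le)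
    linarith
  -- For `t ≥ v i'` no active bump is counted, so the threshold neuron has the value 1.
  · have hs : 2 ^ (2 * a + 1) - (v i' : ℝ)
        ≤ ∑ t : Fin (2 ^ (2 * a + 1)), max (1 - ∑ i, if (t : ℕ) < v i then b i else 0) 0 := by
      rw [← count _ (hv i')]
      refine Finset.sum_le_sum fun t _ => ?_
      split_ifs with ht
      · exact le_max_right _ _
      · rw [Finset.sum_eq_zero, sub_zero]
        · exact le_max_left _ _
        · intro k _
          split_ifs with hk
          · by_contra hne
            have := hmax k (by simpa using lt_of_le_of_ne (b_nonneg k) (Ne.symm hne))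
            omega
          · rfl
    have := mul_le_mul_of_nonneg_left hs (inv_nonneg.2 hpow.le)
    linarith

/-! ### A machine that evaluates the interpolants -/

theorem Primrec.sum_range {α : Type*} [Primcodable α] {n : α → ℕ} {f : α → ℕ → ℕ} (hn : Primrec n)
    (hf : Primrec₂ f) : Primrec fun x => ∑ i ∈ Finset.range (n x), f x i := by
  refine (Primrec.nat_rec' (h := fun x q => q.2 + f x q.1) hn (Primrec.const 0)
    (Primrec.nat_add.comp (Primrec.snd.comp Primrec.snd)
      (hf.comp Primrec.fst (Primrec.fst.comp Primrec.snd))).to₂).of_eq fun x => ?_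
  induction n x with
  | zero => rfl
  | succ k ih => rw [Finset.sum_range_succ, ← ih]

theorem Primrec.nat_pow : Primrec₂ ((· ^ ·) : ℕ → ℕ → ℕ) :=
  Primrec₂.unpaired'.1 Nat.Primrec.pow

/-- The natural number whose binary digits, the least significant one first, are listed. -/
def binaryValue (l : List Bool) : ℕ := l.foldr (fun b n => b.toNat + 2 * n) 0

theorem binaryValue_append (l l' : List Bool) :
    binaryValue (l ++ l') = binaryValue l + 2 ^ l.length * binaryValue l' := by
  induction l with
  | nil => simp [binaryValue]
  | cons b l ih =>
    simp only [binaryValue, List.cons_append, List.foldr_cons, List.length_cons] at ih ⊢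
    rw [ih]; ring

theorem binaryValue_lt (l : List Bool) : binaryValue l < 2 ^ l.length := by
  induction l with
  | nil => simp [binaryValue]
  | cons b l ih =>
    simp only [binaryValue, List.foldr_cons, List.length_cons] at ih ⊢
    have := b.toNat_le
    rw [pow_succ]; omega

theorem exists_binaryValue_eq (n W : ℕ) (hW : W < 2 ^ n) :
    ∃ l : List Bool, l.length = n ∧ binaryValue l = W := by
  induction n generalizing W with
  | zero => exact ⟨[], rfl, by simp at hW; simp [binaryValue, hW]⟩
  | succ n ih =>
    obtain ⟨l, hl, hv⟩ := ih (W / 2) (by rw [pow_succ] at hW; omega)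
    refine ⟨decide (W % 2 = 1) :: l, by simp [hl], ?_⟩
    rw [binaryValue, List.foldr_cons, ← binaryValue, hv]
    rcases Nat.mod_two_eq_zero_or_one W with h | h <;> simp [h] <;> omega

theorem primrec_binaryValue : Primrec binaryValue :=
  Primrec.list_foldr (h := fun _ (q : Bool × ℕ) => q.1.toNat + 2 * q.2) Primrec.id (Primrec.const 0)
    (Primrec.nat_add.comp ((Primrec.dom_bool Bool.toNat).comp (Primrec.fst.comp Primrec.snd))
      (Primrec.nat_mul.comp (Primrec.const 2) (Primrec.snd.comp Primrec.snd))).to₂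

/-- The positive part of `2^m ratOfNat u`, rounded down. -/
def scaledFloor (m u : ℕ) : ℕ :=
  (u.unpair.1.unpair.1 - u.unpair.1.unpair.2) * 2 ^ m / (u.unpair.2 + 1)

/-- As `x ≥ 0`, replacing a negative rational by 0 only brings it closer to `x`; rounding down costs
at most `2^(-m)` more. -/
theorem abs_scaledFloor_sub_le (m u : ℕ) {x ε : ℝ} (hx : 0 ≤ x) (h : |x - (ratOfNat u : ℚ)| ≤ ε) :
    |x - scaledFloor m u / 2 ^ m| ≤ ε + (2 ^ m)⁻¹ := by
  have hq : ((ratOfNat u : ℚ) : ℝ) = ((u.unpair.1.unpair.1 : ℝ) - u.unpair.1.unpair.2)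
      / (u.unpair.2 + 1) := by
    rw [ratOfNat]; push_cast; rfl
  rw [hq] at h
  rw [scaledFloor]
  generalize u.unpair.1.unpair.1 = A at *
  generalize u.unpair.1.unpair.2 = B at *
  generalize u.unpair.2 = C at *
  have hC : (0 : ℝ) < C + 1 := by positivity
  have hm : (0 : ℝ) < 2 ^ m := by positivity
  have h1 : |x - ((A - B : ℕ) : ℝ) / (C + 1)| ≤ ε := by
    rcases le_total B A with hBA | hAB
    · rwa [Nat.cast_sub hBA]
    · rw [Nat.sub_eq_zero_of_le hAB]
      have : ((A : ℝ) - B) / (C + 1) ≤ 0 :=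
        div_nonpos_of_nonpos_of_nonneg (by simpa using hAB) hC.le
      simp only [Nat.cast_zero, zero_div, sub_zero, abs_of_nonneg hx]
      exact (by linarith : x ≤ x - ((A : ℝ) - B) / (C + 1)).trans ((le_abs_self _).trans h)
  generalize A - B = P at *
  have h2 : (((P * 2 ^ m / (C + 1) : ℕ) : ℝ)) ≤ P * 2 ^ m / (C + 1) := by
    simpa using Nat.cast_div_le (α := ℝ) (m := P * 2 ^ m) (n := C + 1)
  have h3 : (P : ℝ) * 2 ^ m / (C + 1) ≤ (P * 2 ^ m / (C + 1) : ℕ) + 1 := by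
    rw [div_le_iff₀ hC]
    have := (Nat.lt_div_mul_add (a := P * 2 ^ m) (Nat.succ_pos C)).le
    have h4 : ((P * 2 ^ m : ℕ) : ℝ) ≤ (P * 2 ^ m / (C + 1) * (C + 1) + (C + 1) : ℕ) := by
      exact_mod_cast this
    push_cast at h4 ⊢
    linarith
  generalize ((P * 2 ^ m / (C + 1) : ℕ) : ℝ) = Y at *
  have h5 : Y / 2 ^ m ≤ P / (C + 1) := by
    rwa [div_le_iff₀ hm, div_mul_eq_mul_div]
  have h6 : (P : ℝ) / (C + 1) ≤ Y / 2 ^ m + (2 ^ m)⁻¹ := by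
    rwa [← one_div, ← add_div, le_div_iff₀ hm, div_mul_eq_mul_div]
  rw [abs_le] at h1 ⊢
  constructor <;> linarith [h1.1, h1.2, inv_pos.2 hm]

/-- `2^m` times `gridBump (2^a)` at the point `y / 2^m`. -/
def natGridBump (d a m : ℕ) (y : ℕ → ℕ) (i : ℕ) : ℕ :=
  2 ^ m - ∑ j ∈ Finset.range d, ((2 ^ a * y j - (gridCoord (2 ^ a) i j + 1) * 2 ^ m)
    + (gridCoord (2 ^ a) i j * 2 ^ m - (2 ^ m + 2 ^ a * y j)))

/-- `2^(a + m)` times the difference of `2^a` and `gridInterpolant a` at the point `y / 2^m`. -/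
def natGridInterpolant (d a m : ℕ) (v y : ℕ → ℕ) : ℕ :=
  ∑ t ∈ Finset.range (2 ^ (2 * a + 1)), (2 ^ m - ∑ i ∈ Finset.range ((2 ^ a) ^ d),
    if t < v i then natGridBump d a m y i else 0)

/-- Truncated subtraction is ReLU, so after clearing denominators the interpolant at a dyadic point
is exact arithmetic in `ℕ`. -/
theorem cast_tsub_eq_max (x y : ℕ) : ((x - y : ℕ) : ℝ) = max ((x : ℝ) - y) 0 := by
  rcases le_total y x with h | h
  · rw [Nat.cast_sub h, max_eq_left (by simpa using h)]
  · rw [Nat.sub_eq_zero_of_le h, max_eq_right (by simpa using h), Nat.cast_zero]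

theorem cast_natGridBump (d a m : ℕ) (y : ℕ → ℕ) (i : ℕ) :
    (natGridBump d a m y i : ℝ)
      = 2 ^ m * gridBump (2 ^ a) (fun j : Fin d => gridCoord (2 ^ a) i j) fun j => y j / 2 ^ m := by
  have hm : (0 : ℝ) < 2 ^ m := by positivity
  rw [natGridBump, ← Fin.sum_univ_eq_sum_range (fun j =>
    (2 ^ a * y j - (gridCoord (2 ^ a) i j + 1) * 2 ^ m)
      + (gridCoord (2 ^ a) i j * 2 ^ m - (2 ^ m + 2 ^ a * y j))), cast_tsub_eq_max, gridBump,
    mul_max_of_nonneg _ _ hm.le, mul_zero, mul_sub, mul_one, Finset.mul_sum]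
  push_cast [cast_tsub_eq_max]
  congr 2
  refine Finset.sum_congr rfl fun j _ => ?_
  rw [mul_add, mul_max_of_nonneg _ _ hm.le, mul_max_of_nonneg _ _ hm.le, mul_zero]
  congr 2 <;> field_simp
  ring

theorem cast_natGridInterpolant (d a m : ℕ) (v y : ℕ → ℕ) :
    gridInterpolant a (fun i : Fin ((2 ^ a) ^ d) => v i) (fun j => y j / 2 ^ m)
      = 2 ^ a - natGridInterpolant d a m v y / 2 ^ (a + m) := by
  have hm : (0 : ℝ) < 2 ^ m := by positivity
  rw [gridInterpolant, natGridInterpolant, ← Fin.sum_univ_eq_sum_range (fun t =>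
    2 ^ m - ∑ i ∈ Finset.range ((2 ^ a) ^ d), if t < v i then natGridBump d a m y i else 0)]
  congr 1
  rw [eq_div_iff (by positivity), pow_add (2 : ℝ) a m, mul_right_comm, ← mul_assoc,
    inv_mul_cancel₀ (by positivity), one_mul, Finset.mul_sum, Nat.cast_sum]
  refine Finset.sum_congr rfl fun t _ => ?_
  rw [← Fin.sum_univ_eq_sum_range (fun i => if (t : ℕ) < v i then natGridBump d a m y i else 0),
    cast_tsub_eq_max, mul_max_of_nonneg _ _ hm.le, mul_zero, mul_sub, mul_one, Finset.mul_sum]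
  push_cast [cast_natGridBump]
  simp only [mul_ite, mul_zero]

/-- The mesh exponent stated by a program: the length of its initial block of ones. -/
def meshExponent (p : List Bool) : ℕ := p.idxOf false

/-- The `i`-th entry of the table of data that follows the initial block of a program. -/
def tableEntry (p : List Bool) (i : ℕ) : ℕ :=
  binaryValue p / 2 ^ (meshExponent p + 1) / (2 ^ (2 * meshExponent p + 1)) ^ i
    % 2 ^ (2 * meshExponent p + 1)

/-- The length of a program with mesh exponent `a`. -/
def programLength (d a : ℕ) : ℕ := a + 1 + (2 ^ a) ^ d * (2 * a + 1)

/-- The index of the point of the tape that yields accuracy `2^(-k)`. -/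
def readingIndex (d a k : ℕ) : ℕ := k + (2 * a + a * d + 3 + d)

/-- The code of the rational number that is output. -/
def interpolantCode (d : ℕ) (q : List Bool × ℕ × List ℕ) : ℕ :=
  let a := meshExponent q.1
  let m := readingIndex d a q.2.1
  Nat.pair (Nat.pair (2 ^ a * 2 ^ (a + m)) (natGridInterpolant d a m (tableEntry q.1)
    fun j => scaledFloor m (q.2.2.getD (m * d + j) 0))) (2 ^ (a + m) - 1)

/-- `ratOfNat` adds one to the coded denominator, hence the last component `2^(a + m) - 1` of the
code. -/
theorem ratOfNat_interpolantCode (d : ℕ) (q : List Bool × ℕ × List ℕ) :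
    ((ratOfNat (interpolantCode d q) : ℚ) : ℝ) = gridInterpolant (d := d) (meshExponent q.1)
      (fun i => tableEntry q.1 i) fun j => scaledFloor (readingIndex d (meshExponent q.1) q.2.1)
        (q.2.2.getD (readingIndex d (meshExponent q.1) q.2.1 * d + j) 0)
          / 2 ^ readingIndex d (meshExponent q.1) q.2.1 := by
  rw [cast_natGridInterpolant d _ _ (tableEntry q.1) fun j =>
    scaledFloor (readingIndex d (meshExponent q.1) q.2.1)
      (q.2.2.getD (readingIndex d (meshExponent q.1) q.2.1 * d + j) 0)]
  simp only [interpolantCode, ratOfNat, Nat.unpair_pair]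
  push_cast [Nat.cast_sub Nat.one_le_two_pow]
  rw [sub_add_cancel, sub_div, mul_div_cancel_right₀ _ (by positivity)]

theorem Primrec.gridCoord {α : Type*} [Primcodable α] {N i j : α → ℕ}
    (hN : Primrec N) (hi : Primrec i) (hj : Primrec j) :
    Primrec fun x => gridCoord (N x) (i x) (j x) :=
  Primrec.nat_mod.comp (Primrec.nat_div.comp hi (Primrec.nat_pow.comp hN hj)) hN

theorem Primrec.two_pow {α : Type*} [Primcodable α] {n : α → ℕ} (hn : Primrec n) : Primrec fun x => 2 ^ n x :=
  Primrec.nat_pow.comp (Primrec.const 2) hn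

theorem Primrec.natGridBump {α : Type*} [Primcodable α] (d : ℕ) {a m i : α → ℕ}
    {y : α → ℕ → ℕ} (ha : Primrec a)
    (hm : Primrec m) (hy : Primrec₂ y) (hi : Primrec i) :
    Primrec fun x => natGridBump d (a x) (m x) (y x) (i x) := by
  have ha' := ha.two_pow.comp (Primrec.fst (α := α) (β := ℕ))
  have hm' := hm.two_pow.comp (Primrec.fst (α := α) (β := ℕ))
  have hc := Primrec.gridCoord ha' (hi.comp Primrec.fst) (Primrec.snd (α := α) (β := ℕ))
  have hay := Primrec.nat_mul.comp ha' hy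
  exact Primrec.nat_sub.comp hm.two_pow <| Primrec.sum_range (Primrec.const d) <|
    Primrec.nat_add.comp
      (Primrec.nat_sub.comp hay (Primrec.nat_mul.comp (Primrec.succ.comp hc) hm'))
      (Primrec.nat_sub.comp (Primrec.nat_mul.comp hc hm') (Primrec.nat_add.comp hm' hay))

theorem Primrec.natGridInterpolant {α : Type*} [Primcodable α] (d : ℕ) {a m : α → ℕ}
    {v y : α → ℕ → ℕ} (ha : Primrec a)
    (hm : Primrec m) (hv : Primrec₂ v) (hy : Primrec₂ y) :
    Primrec fun x => natGridInterpolant d (a x) (m x) (v x) (y x) := by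
  have h₁ : Primrec fun z : (α × ℕ) × ℕ => z.1.1 := Primrec.fst.comp Primrec.fst
  refine Primrec.sum_range (Primrec.two_pow (Primrec.succ.comp
    (Primrec.nat_mul.comp (Primrec.const 2) ha))) <|
    Primrec.nat_sub.comp (hm.two_pow.comp Primrec.fst) <|
    Primrec.sum_range (Primrec.nat_pow.comp (ha.two_pow.comp Primrec.fst) (Primrec.const d)) <|
    Primrec.ite (Primrec.nat_lt.comp (Primrec.snd.comp Primrec.fst) (hv.comp h₁ Primrec.snd))
      (Primrec.natGridBump d (ha.comp h₁) (hm.comp h₁) ?_ Primrec.snd) (Primrec.const 0)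
  exact hy.comp (h₁.comp Primrec.fst) Primrec.snd

theorem primrec_meshExponent : Primrec meshExponent :=
  Primrec.list_idxOf.comp (Primrec.const false) Primrec.id

theorem primrec_tableEntry : Primrec₂ tableEntry := by
  have ha := primrec_meshExponent.comp (Primrec.fst (α := List Bool) (β := ℕ))
  have hb := Primrec.two_pow (Primrec.succ.comp (Primrec.nat_mul.comp (Primrec.const 2) ha))
  exact Primrec.nat_mod.comp (Primrec.nat_div.comp (Primrec.nat_div.comp
    (primrec_binaryValue.comp Primrec.fst) (Primrec.two_pow (Primrec.succ.comp ha)))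
    (Primrec.nat_pow.comp hb Primrec.snd)) hb

theorem primrec_readingIndex (d : ℕ) : Primrec₂ fun a k => readingIndex d a k := by
  have ha : Primrec (Prod.fst : ℕ × ℕ → ℕ) := Primrec.fst
  exact Primrec.nat_add.comp Primrec.snd (Primrec.nat_add.comp (Primrec.nat_add.comp
    (Primrec.nat_add.comp (Primrec.nat_mul.comp (Primrec.const 2) ha)
      (Primrec.nat_mul.comp ha (Primrec.const d))) (Primrec.const 3)) (Primrec.const d))

theorem primrec_programLength (d : ℕ) : Primrec (programLength d) :=
  Primrec.nat_add.comp Primrec.succ (Primrec.nat_mul.comp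
    (Primrec.nat_pow.comp (Primrec.two_pow Primrec.id) (Primrec.const d))
    (Primrec.succ.comp (Primrec.nat_mul.comp (Primrec.const 2) Primrec.id)))

theorem primrec_scaledFloor : Primrec₂ scaledFloor := by
  have hu := Primrec.unpair.comp (Primrec.snd (α := ℕ) (β := ℕ))
  have hu' := Primrec.unpair.comp (Primrec.fst.comp hu)
  exact Primrec.nat_div.comp (Primrec.nat_mul.comp
    (Primrec.nat_sub.comp (Primrec.fst.comp hu') (Primrec.snd.comp hu'))
    (Primrec.two_pow Primrec.fst)) (Primrec.succ.comp (Primrec.snd.comp hu))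

theorem primrec_interpolantCode (d : ℕ) : Primrec (interpolantCode d) := by
  have ha : Primrec fun q : List Bool × ℕ × List ℕ => meshExponent q.1 :=
    primrec_meshExponent.comp Primrec.fst
  have hm : Primrec fun q : List Bool × ℕ × List ℕ => readingIndex d (meshExponent q.1) q.2.1 :=
    (primrec_readingIndex d).comp ha (Primrec.fst.comp Primrec.snd)
  have ham := Primrec.two_pow (Primrec.nat_add.comp ha hm)
  refine Primrec₂.natPair.comp (Primrec₂.natPair.comp (Primrec.nat_mul.comp ha.two_pow ham)
    (Primrec.natGridInterpolant d ha hm ?_ ?_)) (Primrec.pred.comp ham)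
  · exact primrec_tableEntry.comp (Primrec.fst.comp Primrec.fst) Primrec.snd
  · exact primrec_scaledFloor.comp (hm.comp Primrec.fst) ((Primrec.list_getD 0).comp
      (Primrec.snd.comp (Primrec.snd.comp Primrec.fst)) (Primrec.nat_add.comp
        (Primrec.nat_mul.comp (hm.comp Primrec.fst) (Primrec.const d)) Primrec.snd))

/-- The machine that computes the interpolant whose data are listed by its program. -/
def interpolantMachine (d : ℕ) : TypeTwoMachine where
  step q := bif q.1.length == programLength d (meshExponent q.1) then
      Part.some (bif q.2.2.length.blt ((readingIndex d (meshExponent q.1) q.2.1 + 1) * d) then none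
        else some (interpolantCode d q))
    else Part.none
  partrec := by
    have ha : Primrec fun q : List Bool × ℕ × List ℕ => meshExponent q.1 :=
      primrec_meshExponent.comp Primrec.fst
    refine Partrec.cond ?_ (Computable.partrec ?_) Partrec.none
    · exact (Primrec.beq.comp (Primrec.list_length.comp Primrec.fst)
        ((primrec_programLength d).comp ha)).to_comp
    · refine (Primrec.cond ?_ (Primrec.const none)
        (Primrec.option_some.comp (primrec_interpolantCode d))).to_comp
      refine (Primrec.nat_lt.comp (Primrec.list_length.comp (Primrec.snd.comp Primrec.snd))
        (Primrec.nat_mul.comp (Primrec.succ.comp ((primrec_readingIndex d).comp ha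
          (Primrec.fst.comp Primrec.snd))) (Primrec.const d))).decide.of_eq fun q => ?_
      rw [Bool.eq_iff_iff]; simp [Nat.blt_eq]

theorem length_of_interpolantMachine_outputs {d : ℕ} {p : List Bool} {k : ℕ} {o : ℕ → ℕ} {v : ℕ}
    (h : (interpolantMachine d).Outputs p k o v) :
    p.length = programLength d (meshExponent p) := by
  obtain ⟨n, hn, -⟩ := h
  by_contra hne
  have : (p.length == programLength d (meshExponent p)) = false := by simpa using hne
  simp [interpolantMachine, this] at hn

/-- The mesh exponent is fixed by the bits up to the first `false`, and it fixes the length of an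
accepted program. A proper extension keeps the exponent but has the wrong length. -/
theorem interpolantMachine_prefixFree (d : ℕ) : (interpolantMachine d).PrefixFree := by
  rintro p q ⟨k, o, v, hp⟩ ⟨k', o', v', hq⟩ ⟨r, rfl⟩
  have hp := length_of_interpolantMachine_outputs hp
  have hq := length_of_interpolantMachine_outputs hq
  -- Without a `false`, `idxOf` would return the length of `p`, but the required length exceeds the
  -- mesh exponent.
  have hmem : false ∈ p := by
    refine List.idxOf_lt_length_iff.1 ?_
    rw [programLength, meshExponent] at hp
    omega
  rw [meshExponent, List.idxOf_append_of_mem hmem, ← meshExponent, ← hp, List.length_append] at hq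
  have : r = [] := List.length_eq_zero_iff.1 (by omega)
  rw [this, List.append_nil]

theorem interpolantMachine_computes {d : ℕ} {p : List Bool}
    (hp : p.length = programLength d (meshExponent p)) :
    (interpolantMachine d).Computes p (d := d) fun x =>
      gridInterpolant (meshExponent p) (fun i => tableEntry p i) fun j => x.1 j := by
  intro x o ho k
  set a := meshExponent p with ha
  set m := readingIndex d a k with hm
  have hp' : (p.length == programLength d (meshExponent p)) = true := by simpa using hp
  -- The first `(m + 1) * d` symbols are the points with indices `0` to `m`; the machine halts as
  -- soon as it has them.
  refine ⟨interpolantCode d (p, k, (List.range ((m + 1) * d)).map o), ⟨(m + 1) * d, ?_, ?_⟩, ?_⟩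
  · have hblt : ((m + 1) * d).blt ((m + 1) * d) = false :=
      Bool.eq_false_iff.2 (by simp [Nat.blt_eq])
    simp only [interpolantMachine, hp', List.length_map, List.length_range]
    rw [← ha, ← hm, hblt]
    exact Part.mem_some _
  · intro n hn
    have hblt : n.blt ((m + 1) * d) = true := by rwa [Nat.blt_eq]
    simp only [interpolantMachine, hp', List.length_map, List.length_range]
    rw [← ha, ← hm, hblt]
    exact Part.mem_some _
  · rw [ratOfNat_interpolantCode]
    simp only [← ha, ← hm]
    -- One `2^(-m)` is the error of the tape point, the other that of rounding. With the Lipschitz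
    -- bound and the choice of `readingIndex` the total is `2^(-k) d / 2^d`, which is below
    -- `2^(-k)`.
    have hε : (0 : ℝ) < 2 * (2 ^ m)⁻¹ := by positivity
    refine (abs_gridInterpolant_sub_le a _ (ε := 2 * (2 ^ m)⁻¹) (fun j => ?_) hε.le).trans_lt ?_
    · have hlt : m * d + j < (m + 1) * d := by rw [add_mul, one_mul]; simp
      have hget : ((List.range ((m + 1) * d)).map o).getD (m * d + j) 0 = o (m * d + j) := by
        simp [List.getD_eq_getElem?_getD, List.getElem?_range hlt]
      rw [hget, two_mul]
      refine abs_scaledFloor_sub_le m _ (x.2 j).1 ?_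
      rw [← inv_pow]
      refine le_trans ?_ (ho m).le
      exact PiLp.norm_apply_le (x.1 - tapePoint o m) j
    · have hd : (d : ℝ) < 2 ^ d := by exact_mod_cast Nat.lt_two_pow_self
      rw [hm, readingIndex, pow_add _ k, mul_inv, inv_pow]
      have h2 : (2 : ℝ) ^ (2 * a + a * d + 3 + d) = 2 ^ (2 * a + a * d + 2) * 2 * 2 ^ d := by
        rw [← pow_succ, ← pow_add]
      rw [h2]
      have hA : (0 : ℝ) < 2 ^ (2 * a + a * d + 2) := by positivity
      generalize (2 : ℝ) ^ (2 * a + a * d + 2) = A at *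
      have : A * d * (2 * ((2 ^ k)⁻¹ * (A * 2 * 2 ^ d)⁻¹)) = (2 ^ k)⁻¹ * (d / 2 ^ d) := by
        field_simp
      rw [this]
      exact mul_lt_of_lt_one_right (by positivity) ((div_lt_one (by positivity)).2 hd)

/-- Every interpolant is computed by a program of the length that is needed to list its data. -/
theorem exists_program_gridInterpolant {d : ℕ} (a : ℕ) (v : Fin ((2 ^ a) ^ d) → ℕ)
    (hv : ∀ i, v i < 2 ^ (2 * a + 1)) :
    ∃ p : List Bool, p.length = programLength d a ∧
      (interpolantMachine d).Computes p (d := d) fun x => gridInterpolant a v fun j => x.1 j := by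
  -- The table is one number whose digits in base `2^(2a+1)` are the data.
  let W := finFunctionFinEquiv fun i => (⟨v i, hv i⟩ : Fin (2 ^ (2 * a + 1)))
  obtain ⟨w, hw, hval⟩ := exists_binaryValue_eq ((2 ^ a) ^ d * (2 * a + 1)) W
    (W.2.trans_eq (by rw [← pow_mul, mul_comm]))
  have hmesh : meshExponent (List.replicate a true ++ false :: w) = a := by
    rw [meshExponent, List.idxOf_append_of_notMem (by simp)]
    simp
  have hlen : (List.replicate a true ++ false :: w).length = programLength d a := by
    simp [hw, programLength]; omega
  have hentry : (fun i : Fin ((2 ^ a) ^ d) =>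
      tableEntry (List.replicate a true ++ false :: w) i) = v := by
    funext i
    -- The header occupies the `a + 1` least significant bits, so division strips it.
    have h0 : binaryValue (List.replicate a true ++ false :: w) / 2 ^ (a + 1) = W := by
      have := binaryValue_append (List.replicate a true ++ [false]) w
      have hlt := binaryValue_lt (List.replicate a true ++ [false])
      simp only [List.append_assoc, List.singleton_append, List.length_append,
        List.length_replicate, List.length_singleton] at this hlt
      rw [this, hval, Nat.add_mul_div_left _ _ (by positivity), Nat.div_eq_of_lt hlt, zero_add]
    rw [tableEntry, hmesh, h0, ← finFunctionFinEquiv_symm_apply_val, Equiv.symm_apply_apply]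
  refine ⟨_, hlen, ?_⟩
  have := interpolantMachine_computes (d := d) (p := List.replicate a true ++ false :: w)
    (by rw [hlen, hmesh])
  rw [hmesh] at this
  rwa [hentry] at this

/-! ### Approximation of Lipschitz functions -/

theorem dist_cube_le {d : ℕ} {x y : UnitCube d} {r : ℝ} (hr : 0 ≤ r)
    (h : ∀ j, |x.1 j - y.1 j| ≤ r) : dist x y ≤ d * r := by
  rw [Subtype.dist_eq, EuclideanSpace.dist_eq]
  refine Real.sqrt_le_iff.2 ⟨by positivity, ?_⟩
  have h1 : ∀ j ∈ (Finset.univ : Finset (Fin d)), dist (x.1 j) (y.1 j) ^ 2 ≤ r ^ 2 := fun j _ => by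
    rw [Real.dist_eq]; exact pow_le_pow_left₀ (abs_nonneg _) (h j) 2
  refine (Finset.sum_le_sum h1).trans ?_
  rw [Finset.sum_const, Finset.card_univ, Fintype.card_fin, nsmul_eq_mul, mul_pow]
  refine mul_le_mul_of_nonneg_right ?_ (by positivity)
  exact_mod_cast Nat.le_self_pow two_ne_zero d

/-- The interpolant lies between samples at grid points within `2 / 2^a` of `x` in each coordinate.
There `f` differs from `f x` by at most `2 d L / 2^a`, and quantization costs a further `1 / 2^a`.
-/
theorem exists_gridInterpolant_near {d a : ℕ} {L : ℝ≥0} {f : UnitCube d → ℝ} (hf : LipschitzWith L f)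
    (hfa : ∀ x, |f x| < 2 ^ a) :
    ∃ v : Fin ((2 ^ a) ^ d) → ℕ, (∀ i, v i < 2 ^ (2 * a + 1)) ∧
      ∀ x : UnitCube d, |f x - gridInterpolant a v fun j => x.1 j|
        ≤ (1 + 2 * d * L) / 2 ^ a := by
  have hpow : (0 : ℝ) < 2 ^ a := by positivity
  let pt : Fin ((2 ^ a) ^ d) → UnitCube d := fun i =>
    ⟨WithLp.toLp 2 fun j => (gridCoord (2 ^ a) i j : ℝ) / 2 ^ a, fun j => by
      have : gridCoord (2 ^ a) i j < 2 ^ a := Nat.mod_lt _ (by positivity)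
      refine ⟨by simp only; positivity, (div_le_one hpow).2 ?_⟩
      exact_mod_cast this.le⟩
  have hnonneg : ∀ i, 0 ≤ (f (pt i) + 2 ^ a) * 2 ^ a := fun i =>
    mul_nonneg (by linarith [(abs_lt.1 (hfa (pt i))).1]) hpow.le
  have hv : ∀ i, ⌊(f (pt i) + 2 ^ a) * 2 ^ a⌋₊ < 2 ^ (2 * a + 1) := fun i => by
    rw [Nat.floor_lt (hnonneg i)]
    push_cast
    rw [pow_succ, two_mul, pow_add, mul_right_comm]
    have := (abs_lt.1 (hfa (pt i))).2
    gcongr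
    linarith
  refine ⟨fun i => ⌊(f (pt i) + 2 ^ a) * 2 ^ a⌋₊, hv, fun x => ?_⟩
  obtain ⟨i, i', hi, hi', hlow, hup⟩ := gridInterpolant_bounds a
    (fun i => ⌊(f (pt i) + 2 ^ a) * 2 ^ a⌋₊) (fun i => (hv i).le) (fun j => x.1 j) x.2
  have near : ∀ i : Fin ((2 ^ a) ^ d),
      (∀ j : Fin d, |x.1 j - gridCoord (2 ^ a) i j / 2 ^ a| ≤ 2 / 2 ^ a) →
      |f x - f (pt i)| ≤ 2 * d * L / 2 ^ a := by
    intro i hi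
    rw [← Real.dist_eq]
    refine (hf.dist_le_mul x (pt i)).trans ?_
    refine (mul_le_mul_of_nonneg_left (dist_cube_le (by positivity) hi) L.2).trans (le_of_eq ?_)
    simp only [NNReal.val_eq_coe]
    ring
  have h1 := abs_le.1 (near i hi)
  have h2 := abs_le.1 (near i' hi')
  have h3 : (2 ^ a)⁻¹ * (⌊(f (pt i') + 2 ^ a) * 2 ^ a⌋₊ : ℝ) ≤ f (pt i') + 2 ^ a := by
    rw [inv_mul_le_iff₀ hpow, mul_comm (2 ^ a : ℝ)]; exact Nat.floor_le (hnonneg i')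
  have h4 : f (pt i) + 2 ^ a ≤ (2 ^ a)⁻¹ * (⌊(f (pt i) + 2 ^ a) * 2 ^ a⌋₊ : ℝ) + 1 / 2 ^ a := by
    rw [one_div, ← mul_add_one, ← div_eq_inv_mul, le_div_iff₀ hpow]
    exact (Nat.lt_floor_add_one _).le
  rw [add_div, abs_le]
  have h5 : 0 < 1 / (2 : ℝ) ^ a := by positivity
  constructor <;> linarith

/-- Take the first power of two above `M R`. Its exponent is of order `log R` because `R ≥ 2` lets
`log R` absorb the constant `log (2 M)`. -/
theorem exists_mesh {M : ℝ} (hM : 1 ≤ M) :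
    ∃ c : ℝ, 0 < c ∧ ∀ R : ℝ, 2 ≤ R → ∃ a : ℕ, 1 ≤ a ∧ M * R ≤ 2 ^ a ∧ (2 : ℝ) ^ a ≤ 2 * M * R ∧
      Real.log R ≤ a ∧ (a : ℝ) ≤ c * Real.log R := by
  have hlog2 : 0 < Real.log 2 := Real.log_pos (by norm_num)
  have hlog2' : Real.log 2 ≤ 1 := by linarith [Real.log_le_sub_one_of_pos (zero_lt_two' ℝ)]
  have hlogM : 0 ≤ Real.log (2 * M) := Real.log_nonneg (by linarith)
  refine ⟨(Real.log (2 * M) / Real.log 2 + 1) / Real.log 2, by positivity, fun R hR => ?_⟩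
  have hlogR : Real.log 2 ≤ Real.log R := Real.log_le_log (by norm_num) hR
  have hMR : R ≤ M * R := le_mul_of_one_le_left (by linarith) hM
  obtain ⟨n, h1, h2⟩ := exists_nat_pow_near (x := M * R) (y := 2) (by linarith) (by norm_num)
  have hup : (2 : ℝ) ^ (n + 1) ≤ 2 * M * R := by rw [pow_succ]; linarith
  refine ⟨n + 1, by omega, h2.le, hup, ?_, ?_⟩
  · have := Real.log_le_log (by linarith) (hMR.trans h2.le)
    rw [Real.log_pow] at this
    exact this.trans (mul_le_of_le_one_right (by positivity) hlog2')
  · have := Real.log_le_log (by positivity) hup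
    rw [Real.log_pow, Real.log_mul (by linarith) (by linarith)] at this
    have h3 : Real.log (2 * M) ≤ Real.log (2 * M) / Real.log 2 * Real.log R := by
      rw [div_mul_eq_mul_div, le_div_iff₀ hlog2]; gcongr
    rw [div_mul_eq_mul_div, le_div_iff₀ hlog2, add_mul, one_mul]
    linarith

theorem programLength_add_le {d a s : ℕ} (ha : 1 ≤ a) {M R c : ℝ} (hM : 0 ≤ M) (hR : 1 ≤ R)
    (hpow : (2 : ℝ) ^ a ≤ 2 * M * R) (hlog : (a : ℝ) ≤ c * Real.log R) :
    ((s + programLength d a : ℕ) : ℝ) ≤ (s + 5) * c * (2 * M) ^ d * (R ^ d * Real.log R) := by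
  have hX : 1 ≤ (2 ^ a) ^ d := Nat.one_le_pow _ _ (by positivity)
  -- Five multiples of `a (2^a)^d` cover `a`, `1` and the table with its `2a + 1` bits per entry.
  have h1 : s + programLength d a ≤ (s + 5) * (a * (2 ^ a) ^ d) := by
    rw [programLength]
    generalize (2 ^ a) ^ d = X at *
    have h2 : a * 1 ≤ a * X := Nat.mul_le_mul_left a hX
    have h3 : 1 * X ≤ a * X := Nat.mul_le_mul_right X ha
    have h4 : s * 1 ≤ s * (a * X) := Nat.mul_le_mul_left s (by nlinarith)
    nlinarith
  have h2 : ((s + programLength d a : ℕ) : ℝ) ≤ (s + 5) * (a * (2 ^ a) ^ d) := by exact_mod_cast h1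
  refine h2.trans ?_
  have h3 : ((2 : ℝ) ^ a) ^ d ≤ (2 * M * R) ^ d := pow_le_pow_left₀ (by positivity) hpow d
  calc ((s : ℝ) + 5) * (a * (2 ^ a) ^ d) ≤ (s + 5) * (c * Real.log R * (2 * M * R) ^ d) := by
        have : 0 ≤ c * Real.log R := (Nat.cast_nonneg a).trans hlog
        gcongr
    _ = _ := by rw [mul_pow (2 * M)]; ring

theorem kolmogorovComplexity_le {U : TypeTwoMachine} {d : ℕ} {g : UnitCube d → ℝ} {p : List Bool}
    (h : U.Computes p g) : kolmogorovComplexity U g ≤ p.length :=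
  iInf_le (fun p : {p : List Bool // U.Computes p g} => (p.1.length : ℕ∞)) ⟨p, h⟩

/-- Lipschitz functions are approximated by networks of depth four and of logarithmic precision
whose complexity is bounded by the size of a table of values. -/
theorem exists_network_of_lipschitz (U : TypeTwoMachine) (hU : U.IsUniversal) (d : ℕ) (B : ℝ)
    (hB : 0 < B) : ∃ C c₁ c₂ : ℝ, 0 < C ∧ 0 < c₁ ∧ 0 < c₂ ∧
      ∀ (L : ℝ≥0) (f : UnitCube d → ℝ) (δ : ℝ),
        1 / B ≤ (L : ℝ) → LipschitzWith L f → (∀ x, |f x| ≤ B) → 0 < δ →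
        ∃ (g : ReLUNetwork d) (p : ℕ),
          g.depth ≤ 4 ∧ g.HasPrecision p ∧
          c₁ * Real.log (max (L / δ) 2) ≤ (p : ℝ) ∧ (p : ℝ) ≤ c₂ * Real.log (max (L / δ) 2) ∧
          worstCaseError f g.onCube ≤ ENNReal.ofReal δ ∧
          (kolmogorovComplexity U g.onCube : ℝ≥0∞) ≤
            ENNReal.ofReal (C * ((max (L / δ) 2) ^ d * Real.log (max (L / δ) 2)
              + d * Real.log d)) := by
  obtain ⟨s, hs⟩ := hU.2 (interpolantMachine d) (interpolantMachine_prefixFree d)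
  -- `B` pays for quantization and `2 d` for the variation of `f` near `x`; the 1 ensures `1 ≤ M`
  -- and `B < 2^a`.
  set M : ℝ := B + 2 * d + 1 with hM
  have hM1 : 1 ≤ M := by rw [hM]; linarith [(Nat.cast_nonneg d : (0 : ℝ) ≤ d)]
  obtain ⟨c, hc, hmesh⟩ := exists_mesh hM1
  refine ⟨(s.length + 5) * c * (2 * M) ^ d, 1, c, by positivity, one_pos, hc,
    fun L f δ hL hf hfB hδ => ?_⟩
  set R : ℝ := max (L / δ) 2 with hR
  have hR2 : 2 ≤ R := le_max_right _ _
  have hLδ : L ≤ R * δ := (div_le_iff₀ hδ).1 (le_max_left _ _)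
  obtain ⟨a, ha, hlow, hup, hlog, hlog'⟩ := hmesh R hR2
  have hpow : (0 : ℝ) < 2 ^ a := by positivity
  obtain ⟨v, hv, hfv⟩ := exists_gridInterpolant_near (a := a) hf fun x => (hfB x).trans_lt <| by
    have : M ≤ M * R := le_mul_of_one_le_right (by linarith) (by linarith)
    have hd : (0 : ℝ) ≤ d := Nat.cast_nonneg d
    linarith
  obtain ⟨g, hdepth, hprec, heval⟩ := exists_network_gridInterpolant a v
  have hg : g.onCube = fun x : UnitCube d => gridInterpolant a v fun j => x.1 j := by
    funext x; rw [ReLUNetwork.onCube, heval]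
  refine ⟨g, a, hdepth.le, hprec, by rwa [one_mul], hlog', ?_, ?_⟩
  · rw [hg]
    refine iSup_le fun x => ?_
    rw [edist_dist]
    refine ENNReal.ofReal_le_ofReal ?_
    rw [Real.dist_eq]
    refine (hfv x).trans ?_
    rw [div_le_iff₀ hpow]
    -- Here `1 / B ≤ L` enters: the quantization error, which does not scale with `L`, is bounded by
    -- a multiple of `R δ`.
    have h1 : 1 ≤ B * (R * δ) := by
      rw [div_le_iff₀ hB] at hL
      nlinarith
    have h2 : 2 * d * (L : ℝ) ≤ 2 * d * (R * δ) := by gcongr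
    have h3 : δ * (M * R) ≤ δ * 2 ^ a := by gcongr
    have h4 : 0 < R * δ := by positivity
    rw [hM] at h3
    linarith
  · obtain ⟨w, hw, hcomp⟩ := exists_program_gridInterpolant a v hv
    rw [← hg] at hcomp
    have hUcomp : U.Computes (s ++ w) g.onCube := fun x o ho k => by
      obtain ⟨r, hr, hr'⟩ := hcomp x o ho k
      exact ⟨r, (hs w k o r).2 hr, hr'⟩
    have h1 : (kolmogorovComplexity U g.onCube : ℝ≥0∞) ≤ ((s ++ w).length : ℕ∞) :=
      ENat.toENNReal_le.2 (kolmogorovComplexity_le hUcomp)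
    refine h1.trans ?_
    rw [List.length_append, hw, ENat.toENNReal_coe, ← ENNReal.ofReal_natCast]
    refine ENNReal.ofReal_le_ofReal ((programLength_add_le ha (by linarith) (by linarith)
      hup hlog').trans (mul_le_mul_of_nonneg_left ?_ (by positivity)))
    -- The table bound already fits into the `R^d log R` term; the summand `d log d` only has to be
    -- nonnegative.
    have : 0 ≤ d * Real.log d := mul_nonneg (Nat.cast_nonneg d) (Real.log_natCast_nonneg d)
    linarith

end

theorem mainTheorem10 (U : TypeTwoMachine) (hU : U.IsUniversal) (d : ℕ) (hd : 1 ≤ d) :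
    (∃ D : ℕ, ∀ B : ℝ, 0 < B → ∃ C c₁ c₂ : ℝ, 0 < C ∧ 0 < c₁ ∧ 0 < c₂ ∧
      ∀ (L : ℝ≥0) (f : UnitCube d → ℝ) (δ : ℝ),
        1 / B ≤ (L : ℝ) → LipschitzWith L f → (∀ x, |f x| ≤ B) → 0 < δ →
        ∃ (g : ReLUNetwork d) (p : ℕ),
          g.depth ≤ D ∧ g.HasPrecision p ∧
          c₁ * Real.log (max (L / δ) 2) ≤ (p : ℝ) ∧ (p : ℝ) ≤ c₂ * Real.log (max (L / δ) 2) ∧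
          worstCaseError f g.onCube ≤ ENNReal.ofReal δ ∧
          (kolmogorovComplexity U g.onCube : ℝ≥0∞) ≤
            ENNReal.ofReal (C * ((max (L / δ) 2) ^ d * Real.log (max (L / δ) 2)
              + d * Real.log d))) ∧
    (∀ D : ℕ, ∃ c : ℝ, 0 < c ∧ ∀ (B : ℝ) (L : ℝ≥0), 0 < B → 0 < L → ∃ δ₀ : ℝ, 0 < δ₀ ∧
      ∀ δ : ℝ, 0 < δ → δ < δ₀ →
        ∃ f : UnitCube d → ℝ, LipschitzWith L f ∧ (∀ x, |f x| ≤ B) ∧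
          ∀ (g : ReLUNetwork d) (p : ℕ), g.depth ≤ D → g.HasPrecision p →
            worstCaseError f g.onCube ≤ ENNReal.ofReal δ → c * Real.log (L / δ) ≤ (p : ℝ)) := by
  exact ⟨⟨4, fun B hB => exists_network_of_lipschitz U hU d B hB⟩, exists_precision_lower_bound d⟩
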